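/- **Corollary 5.7.** Let $\mathbb K$ be $\mathbb R$ or $\mathbb C$ and let $u=(u_1,u_2,u_3):(\mathbb K^2,\mathbf 0)\to(\mathbb K^3,\mathbf 0)$ be a $\mathbb K$-analytic germ. Put $w_i(x,y)=u_i(x)-u_i(y)$ for $x=(x_1,x_2)$, $y=(y_1,y_2)$ and $1\le i\le 3$, and let $c_{ik}$ ($1\le i\le 3$, $k=1,2$) be any analytic germs at the origin of $\mathbb K^2\times\mathbb K^2$ such that $$w_i(x,y)=c_{i1}(x,y)(x_1-y_1)+c_{i2}(x,y)(x_2-y_2).$$ For $1\le i<j\le 3$ put $$W_{ij}=\begin{vmatrix} c_{i1}&c_{i2}\\ c_{j1}&c_{j2}\end{vmatrix}.$$ For $(x,y,z)\in\mathbb K^2\times\mathbb K^2\times\mathbb K^2$ let $S_1,\dots,S_{15}$ be the fifteen analytic germs $$\begin{gathered} w_1(x,y),\ w_2(x,y),\ w_3(x,y),\quad w_1(y,z),\ w_2(y,z),\ w_3(y,z),\\ W_{12}(x,y),\ W_{13}(x,y),\ W_{23}(x,y),\quad W_{12}(y,z),\ W_{13}(y,z),\ W_{23}(y,z),\quad W_{12}(x,z),\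 W_{13}(x,z),\ W_{23}(x,z).\end{gathered}$$ Let $\mathbb K\{x,y,z\}$ be the ring of convergent power series in the six variables $x_1,x_2,y_1,y_2,z_1,z_2$, i.e. the ring of germs at the origin of analytic functions $\mathbb K^6\to\mathbb K$. Suppose that $u$ has an isolated singular point at the origin, i.e. there is a neighbourhood of the origin in which the derivative matrix of $u$ has rank $2$ except (possibly) at the origin, and that $$\dim_{\mathbb K}\ \mathbb K\{x,y,z\}/\langle S_1,\dots,S_{15}\rangle<\infty .$$ Then $u$ has no triple points near the origin: there is a neighbourhood $U$ of the origin in $\mathbb K^2$ such that no three pairwise distinct points $p,q,r\in U$ satisfy $u(p)=u(q)=u(r)$. -/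

import Mathlib

open Filter Topology

/-- Germs of `R`-valued functions along a filter form an `R`-algebra, with the pointwise scalar
multiplication that Mathlib already provides. -/
noncomputable instance germAlgebra (R : Type*) [CommRing R] {α : Type*} (l : Filter α) :
    Algebra R (Germ l R) :=
  Algebra.ofModule
    (fun r f g => by
      induction f, g using Germ.inductionOn₂ with
      | h f g => exact congrArg (fun h : α → R => (h : Germ l R)) (smul_mul_assoc r f g))
    (fun r f g => by
      induction f, g using Germ.inductionOn₂ with
      | h f g => exact congrArg (fun h : α → R => (h : Germ l R)) (mul_smul_comm r f g))

/-- The `𝕜`-algebra of germs at the origin of analytic functions `E → 𝕜`. For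
`E = 𝕜ⁿ` this is the ring of convergent power series in `n` variables. -/
noncomputable def analyticGerms (𝕜 E : Type*) [NontriviallyNormedField 𝕜] [NormedAddCommGroup E]
    [NormedSpace 𝕜 E] : Subalgebra 𝕜 (Germ (𝓝 (0 : E)) 𝕜) where
  carrier := {g | ∃ f : E → 𝕜, AnalyticAt 𝕜 f 0 ∧ g = (f : Germ (𝓝 (0 : E)) 𝕜)}
  mul_mem' := by
    rintro _ _ ⟨f, hf, rfl⟩ ⟨g, hg, rfl⟩
    exact ⟨f * g, hf.mul hg, rfl⟩
  add_mem' := by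
    rintro _ _ ⟨f, hf, rfl⟩ ⟨g, hg, rfl⟩
    exact ⟨f + g, hf.add hg, rfl⟩
  algebraMap_mem' := fun a => ⟨a • 1, analyticAt_const.smul analyticAt_const, rfl⟩

/-- The germ at the origin of a function that is analytic there. -/
noncomputable def analyticGerm {𝕜 E : Type*} [NontriviallyNormedField 𝕜] [NormedAddCommGroup E]
    [NormedSpace 𝕜 E] (f : E → 𝕜) (hf : AnalyticAt 𝕜 f 0) : analyticGerms 𝕜 E :=
  ⟨(f : Germ (𝓝 (0 : E)) 𝕜), f, hf, rfl⟩

/-- The plane `𝕜²`. -/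
abbrev Plane (𝕜 : Type*) := Fin 2 → 𝕜

/-- The space `𝕜³`. -/
abbrev Space (𝕜 : Type*) := Fin 3 → 𝕜

section

variable {𝕜 : Type*} [NontriviallyNormedField 𝕜]

/-- The `3 × 2` derivative matrix `Du(x)`, with entries `∂uᵢ/∂xₖ (x)`. -/
noncomputable def jacobianMatrix (u : Plane 𝕜 → Space 𝕜) (x : Plane 𝕜) :
    Matrix (Fin 3) (Fin 2) 𝕜 :=
  LinearMap.toMatrix' (fderiv 𝕜 u x : Plane 𝕜 →ₗ[𝕜] Space 𝕜)

/-- Some neighbourhood of the origin contains no critical point of `u` other than, possibly, the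
origin: there `Du` has rank `2` except at the origin. -/
def HasIsolatedCriticalPoint (u : Plane 𝕜 → Space 𝕜) : Prop :=
  ∀ᶠ x in 𝓝[≠] (0 : Plane 𝕜), (jacobianMatrix u x).rank = 2

/-- `wᵢ(x, y) = uᵢ(x) - uᵢ(y)`. -/
def selfDiff (u : Plane 𝕜 → Space 𝕜) (i : Fin 3) (p : Plane 𝕜 × Plane 𝕜) : 𝕜 :=
  u p.1 i - u p.2 i

/-- The `cᵢₖ` are analytic germs at the origin of `𝕜² × 𝕜²` such that
`wᵢ(x, y) = cᵢ₁(x, y) (x₁ - y₁) + cᵢ₂(x, y) (x₂ - y₂)` for `(x, y)` near the origin. -/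
structure IsDivision (u : Plane 𝕜 → Space 𝕜)
    (c : Fin 3 → Fin 2 → Plane 𝕜 × Plane 𝕜 → 𝕜) : Prop where
  analyticAt : ∀ i k, AnalyticAt 𝕜 (c i k) 0
  eventually_eq : ∀ i, ∀ᶠ p in 𝓝 (0 : Plane 𝕜 × Plane 𝕜),
    selfDiff u i p = c i 0 p * (p.1 0 - p.2 0) + c i 1 p * (p.1 1 - p.2 1)

/-- `Wᵢⱼ`, the determinant of the matrix with rows `(cᵢ₁, cᵢ₂)` and `(cⱼ₁, cⱼ₂)`. -/
def divMinor (c : Fin 3 → Fin 2 → Plane 𝕜 × Plane 𝕜 → 𝕜) (i j : Fin 3)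
    (p : Plane 𝕜 × Plane 𝕜) : 𝕜 :=
  Matrix.det !![c i 0 p, c i 1 p; c j 0 p, c j 1 p]

/-- The functions `S₁, …, S₁₅` of `(x, y, z) ∈ 𝕜² × 𝕜² × 𝕜²`. Indices start at `0`, so that
`W₁₂`, `W₁₃`, `W₂₃` are `divMinor c 0 1`, `divMinor c 0 2`, `divMinor c 1 2`. -/
def tripleFun (u : Plane 𝕜 → Space 𝕜) (c : Fin 3 → Fin 2 → Plane 𝕜 × Plane 𝕜 → 𝕜) :
    Fin 15 → Plane 𝕜 × Plane 𝕜 × Plane 𝕜 → 𝕜 :=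
  ![fun (x, y, _) => selfDiff u 0 (x, y),
    fun (x, y, _) => selfDiff u 1 (x, y),
    fun (x, y, _) => selfDiff u 2 (x, y),
    fun (_, y, z) => selfDiff u 0 (y, z),
    fun (_, y, z) => selfDiff u 1 (y, z),
    fun (_, y, z) => selfDiff u 2 (y, z),
    fun (x, y, _) => divMinor c 0 1 (x, y),
    fun (x, y, _) => divMinor c 0 2 (x, y),
    fun (x, y, _) => divMinor c 1 2 (x, y),
    fun (_, y, z) => divMinor c 0 1 (y, z),
    fun (_, y, z) => divMinor c 0 2 (y, z),
    fun (_, y, z) => divMinor c 1 2 (y, z),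
    fun (x, _, z) => divMinor c 0 1 (x, z),
    fun (x, _, z) => divMinor c 0 2 (x, z),
    fun (x, _, z) => divMinor c 1 2 (x, z)]

theorem analyticAt_selfDiff {u : Plane 𝕜 → Space 𝕜} (hu : AnalyticAt 𝕜 u 0) (i : Fin 3) :
    AnalyticAt 𝕜 (selfDiff u i) 0 := by
  have h : AnalyticAt 𝕜 (fun x => u x i) 0 :=
    ((ContinuousLinearMap.proj (R := 𝕜) (φ := fun _ : Fin 3 => 𝕜) i).analyticAt _).comp hu
  exact (AnalyticAt.comp (x := (0 : Plane 𝕜 × Plane 𝕜)) (f := Prod.fst) h analyticAt_fst).sub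
    (AnalyticAt.comp (x := (0 : Plane 𝕜 × Plane 𝕜)) (f := Prod.snd) h analyticAt_snd)

theorem analyticAt_divMinor {c : Fin 3 → Fin 2 → Plane 𝕜 × Plane 𝕜 → 𝕜}
    (hc : ∀ i k, AnalyticAt 𝕜 (c i k) 0) (i j : Fin 3) : AnalyticAt 𝕜 (divMinor c i j) 0 := by
  have h := ((hc i 0).mul (hc j 1)).sub ((hc i 1).mul (hc j 0))
  refine h.congr (Eventually.of_forall fun p => ?_)
  simp [divMinor, Matrix.det_fin_two]

theorem analyticAt_tripleFun {u : Plane 𝕜 → Space 𝕜} (hu : AnalyticAt 𝕜 u 0)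
    {c : Fin 3 → Fin 2 → Plane 𝕜 × Plane 𝕜 → 𝕜} (hc : ∀ i k, AnalyticAt 𝕜 (c i k) 0)
    (j : Fin 15) : AnalyticAt 𝕜 (tripleFun u c j) 0 := by
  have h1 : AnalyticAt 𝕜 (fun p : Plane 𝕜 × Plane 𝕜 × Plane 𝕜 => p.1) 0 := analyticAt_fst
  have h23 : AnalyticAt 𝕜 (fun p : Plane 𝕜 × Plane 𝕜 × Plane 𝕜 => p.2) 0 := analyticAt_snd
  have h2 : AnalyticAt 𝕜 (fun p : Plane 𝕜 × Plane 𝕜 × Plane 𝕜 => p.2.1) 0 :=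
    AnalyticAt.comp (f := fun p : Plane 𝕜 × Plane 𝕜 × Plane 𝕜 => p.2) analyticAt_fst h23
  have h3 : AnalyticAt 𝕜 (fun p : Plane 𝕜 × Plane 𝕜 × Plane 𝕜 => p.2.2) 0 :=
    AnalyticAt.comp (f := fun p : Plane 𝕜 × Plane 𝕜 × Plane 𝕜 => p.2) analyticAt_snd h23
  have hxy {g : Plane 𝕜 × Plane 𝕜 → 𝕜} (hg : AnalyticAt 𝕜 g 0) :
      AnalyticAt 𝕜 (fun p : Plane 𝕜 × Plane 𝕜 × Plane 𝕜 => g (p.1, p.2.1)) 0 :=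
    AnalyticAt.comp (x := (0 : Plane 𝕜 × Plane 𝕜 × Plane 𝕜))
      (f := fun p => (p.1, p.2.1)) hg (h1.prod h2)
  have hyz {g : Plane 𝕜 × Plane 𝕜 → 𝕜} (hg : AnalyticAt 𝕜 g 0) :
      AnalyticAt 𝕜 (fun p : Plane 𝕜 × Plane 𝕜 × Plane 𝕜 => g (p.2.1, p.2.2)) 0 :=
    AnalyticAt.comp (x := (0 : Plane 𝕜 × Plane 𝕜 × Plane 𝕜))
      (f := fun p => (p.2.1, p.2.2)) hg (h2.prod h3)
  have hxz {g : Plane 𝕜 × Plane 𝕜 → 𝕜} (hg : AnalyticAt 𝕜 g 0) :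
      AnalyticAt 𝕜 (fun p : Plane 𝕜 × Plane 𝕜 × Plane 𝕜 => g (p.1, p.2.2)) 0 :=
    AnalyticAt.comp (x := (0 : Plane 𝕜 × Plane 𝕜 × Plane 𝕜))
      (f := fun p => (p.1, p.2.2)) hg (h1.prod h3)
  have hw := analyticAt_selfDiff hu
  have hW := analyticAt_divMinor hc
  fin_cases j
  exacts [hxy (hw 0), hxy (hw 1), hxy (hw 2), hyz (hw 0), hyz (hw 1), hyz (hw 2),
    hxy (hW 0 1), hxy (hW 0 2), hxy (hW 1 2), hyz (hW 0 1), hyz (hW 0 2), hyz (hW 1 2),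
    hxz (hW 0 1), hxz (hW 0 2), hxz (hW 1 2)]

/-- The ideal `⟨S₁, …, S₁₅⟩` of `𝕜{x, y, z}`. -/
noncomputable def tripleIdeal (u : Plane 𝕜 → Space 𝕜) (c : Fin 3 → Fin 2 → Plane 𝕜 × Plane 𝕜 → 𝕜)
    (hu : AnalyticAt 𝕜 u 0) (hc : ∀ i k, AnalyticAt 𝕜 (c i k) 0) :
    Ideal (analyticGerms 𝕜 (Plane 𝕜 × Plane 𝕜 × Plane 𝕜)) :=
  Ideal.span (Set.range fun j =>
    analyticGerm (tripleFun u c j) (analyticAt_tripleFun hu hc j))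

/-- The germ of `u` at the origin has no triple points: on some neighbourhood of the origin, `u`
does not take the same value at three pairwise distinct points. -/
def HasNoTriplePoints (u : Plane 𝕜 → Space 𝕜) : Prop :=
  ∃ U ∈ 𝓝 (0 : Plane 𝕜), ∀ p ∈ U, ∀ q ∈ U, ∀ r ∈ U,
    ¬ (p ≠ q ∧ q ≠ r ∧ p ≠ r ∧ u p = u q ∧ u q = u r)

end

/-! In a finite-dimensional quotient every element is integral over `𝕜`. So for an analytic `t` with
`t 0 = 0` some monic `P` has `P(t)` in the ideal. Near the origin, `t` therefore takes only roots of
`P` as values on the common zeros; the roots are finite in number and `t` is continuous with `t 0 =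
0`, so `t` vanishes there (`eventually_eq_zero_of_finite_quotient`). This easy half of the
Nullstellensatz holds over any nontrivially normed field. Applied to `x₁ - y₁` and `x₂ - y₂`, it
forces `x = y` on the common zeros near the origin. A triple point `(p, q, r)` near the origin is
such a zero (`divMinor_eq_zero` handles the minors), yet `p ≠ q`. -/

/-- A germ in the ideal spanned by the germs of the `S j` vanishes at the common zeros of the `S j`
near the origin. -/
theorem eventually_eq_zero_of_mem_span {𝕜 E ι : Type*} [NontriviallyNormedField 𝕜]
    [NormedAddCommGroup E] [NormedSpace 𝕜 E] {S : ι → E → 𝕜} (hS : ∀ j, AnalyticAt 𝕜 (S j) 0)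
    {g : analyticGerms 𝕜 E}
    (hg : g ∈ Ideal.span (Set.range fun j => analyticGerm (S j) (hS j))) :
    ∃ f : E → 𝕜, (g : Germ (𝓝 (0 : E)) 𝕜) = (f : Germ (𝓝 (0 : E)) 𝕜) ∧
      ∀ x, (∀ j, S j x = 0) → f x = 0 := by
  -- The representative `f` vanishes at every common zero, not only at nearby ones, so the induction
  -- shrinks no neighbourhood.
  induction hg using Submodule.span_induction with
  | mem g hg =>
    obtain ⟨j, rfl⟩ := hg
    exact ⟨S j, rfl, fun x hx => hx j⟩
  | zero => exact ⟨0, rfl, fun x _ => rfl⟩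
  | add a b _ _ ha hb =>
    obtain ⟨f, hf, hf0⟩ := ha
    obtain ⟨h, hh, hh0⟩ := hb
    refine ⟨f + h, ?_, fun x hx => by simp [hf0 x hx, hh0 x hx]⟩
    rw [Germ.coe_add, ← hf, ← hh]
    rfl
  | smul a b _ hb =>
    obtain ⟨f, hf, hf0⟩ := hb
    obtain ⟨h, _, hh⟩ := a.2
    refine ⟨h * f, ?_, fun x hx => by simp [hf0 x hx]⟩
    rw [Germ.coe_mul, ← hf, ← hh]
    rfl

/-- Polynomials act on germs pointwise. -/
theorem coe_aeval_analyticGerm {𝕜 E : Type*} [NontriviallyNormedField 𝕜]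
    [NormedAddCommGroup E] [NormedSpace 𝕜 E] {t : E → 𝕜} (ht : AnalyticAt 𝕜 t 0)
    (P : Polynomial 𝕜) :
    ((Polynomial.aeval (analyticGerm t ht) P : analyticGerms 𝕜 E) : Germ (𝓝 (0 : E)) 𝕜) =
      ((fun x => P.eval (t x) : E → 𝕜) : Germ (𝓝 (0 : E)) 𝕜) := by
  induction P using Polynomial.induction_on' with
  | add P Q hP hQ =>
    simp only [map_add, Polynomial.eval_add, Subalgebra.coe_add, hP, hQ]
    rfl
  | monomial n a =>
    rw [Polynomial.aeval_monomial, ← Algebra.smul_def]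
    simp only [Polynomial.eval_monomial, Subalgebra.coe_smul, Subalgebra.coe_pow]
    rfl

/-- If the germs of the `S j` span an ideal of finite codimension, then an analytic function that
vanishes at the origin vanishes at the common zeros of the `S j` near the origin. -/
theorem eventually_eq_zero_of_finite_quotient {𝕜 E ι : Type*} [NontriviallyNormedField 𝕜]
    [NormedAddCommGroup E] [NormedSpace 𝕜 E] {S : ι → E → 𝕜} (hS : ∀ j, AnalyticAt 𝕜 (S j) 0)
    (hfin : Module.Finite 𝕜 (analyticGerms 𝕜 E ⧸
      Ideal.span (Set.range fun j => analyticGerm (S j) (hS j))))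
    {t : E → 𝕜} (ht : AnalyticAt 𝕜 t 0) (ht0 : t 0 = 0) :
    ∀ᶠ x in 𝓝 (0 : E), (∀ j, S j x = 0) → t x = 0 := by
  set I := Ideal.span (Set.range fun j => analyticGerm (S j) (hS j))
  obtain ⟨P, hPm, hP⟩ := (Algebra.IsIntegral.of_finite 𝕜 (analyticGerms 𝕜 E ⧸ I)).isIntegral
    (Ideal.Quotient.mkₐ 𝕜 I (analyticGerm t ht))
  rw [← Polynomial.aeval_def, Polynomial.aeval_algHom_apply, Ideal.Quotient.mkₐ_eq_mk,
    Ideal.Quotient.eq_zero_iff_mem] at hP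
  obtain ⟨f, hf, hf0⟩ := eventually_eq_zero_of_mem_span hS hP
  rw [coe_aeval_analyticGerm] at hf
  -- The nonzero roots form a finite, hence closed, set that misses `0`.
  have hroots : ∀ᶠ a in 𝓝 (0 : 𝕜), a ∉ P.rootSet 𝕜 \ {0} :=
    ((P.rootSet_finite 𝕜).sdiff.isClosed.isOpen_compl).mem_nhds (by simp)
  have htend : Tendsto t (𝓝 0) (𝓝 0) := by simpa [ht0] using ht.continuousAt.tendsto
  filter_upwards [Germ.coe_eq.1 hf, htend.eventually hroots] with x hx hxr hSx
  by_contra hne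
  refine hxr ⟨?_, hne⟩
  rw [Polynomial.mem_rootSet]
  refine ⟨hPm.ne_zero, ?_⟩
  rw [Polynomial.coe_aeval_eq_eval, hx, hf0 x hSx]

/-- The minors of a division vanish at the pairs of distinct points with the same image. -/
theorem divMinor_eq_zero {𝕜 : Type*} [NontriviallyNormedField 𝕜]
    {c : Fin 3 → Fin 2 → Plane 𝕜 × Plane 𝕜 → 𝕜} {p q : Plane 𝕜} (hpq : p ≠ q)
    (h : ∀ i, c i 0 (p, q) * (p 0 - q 0) + c i 1 (p, q) * (p 1 - q 1) = 0) (i j : Fin 3) :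
    divMinor c i j (p, q) = 0 := by
  -- By `h`, the nonzero vector `p - q` lies in the kernel of the 2 × 2 matrix.
  refine Matrix.exists_mulVec_eq_zero_iff.1 ⟨p - q, sub_ne_zero.2 hpq, ?_⟩
  ext k
  fin_cases k <;> simp [Matrix.mulVec, dotProduct, Fin.sum_univ_two, h]

theorem corollary5p7 {𝕜 : Type*} [RCLike 𝕜]
    (u : Plane 𝕜 → Space 𝕜) (hu : AnalyticAt 𝕜 u 0) (hu0 : u 0 = 0)
    (hcrit : HasIsolatedCriticalPoint u)
    (c : Fin 3 → Fin 2 → Plane 𝕜 × Plane 𝕜 → 𝕜) (hc : IsDivision u c)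
    (hfin : Module.Finite 𝕜
      (analyticGerms 𝕜 (Plane 𝕜 × Plane 𝕜 × Plane 𝕜) ⧸ tripleIdeal u c hu hc.analyticAt)) :
    HasNoTriplePoints u := by
  have hcoord (k : Fin 2) : ∀ᶠ x in 𝓝 (0 : Plane 𝕜 × Plane 𝕜 × Plane 𝕜),
      (∀ j, tripleFun u c j x = 0) → x.1 k - x.2.1 k = 0 := by
    let π : Plane 𝕜 →L[𝕜] 𝕜 := ContinuousLinearMap.proj k
    let L : (Plane 𝕜 × Plane 𝕜 × Plane 𝕜) →L[𝕜] 𝕜 :=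
      π.comp (ContinuousLinearMap.fst 𝕜 _ _) -
        π.comp ((ContinuousLinearMap.fst 𝕜 _ _).comp (ContinuousLinearMap.snd 𝕜 _ _))
    exact eventually_eq_zero_of_finite_quotient (analyticAt_tripleFun hu hc.analyticAt) hfin
      (L.analyticAt 0) (map_zero L)
  have hdiv := eventually_all.2 hc.eventually_eq
  -- The division identity holds only near the origin; one `V` serves all three pairs taken from
  -- `p`, `q`, `r`.
  obtain ⟨V, hV, hVdiv⟩ : ∃ V ∈ 𝓝 (0 : Plane 𝕜), ∀ p ∈ V, ∀ q ∈ V, ∀ i,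
      selfDiff u i (p, q) = c i 0 (p, q) * (p 0 - q 0) + c i 1 (p, q) * (p 1 - q 1) := by
    rw [Prod.zero_eq_mk, nhds_prod_eq, Filter.Eventually, mem_prod_self_iff] at hdiv
    obtain ⟨V, hV, h⟩ := hdiv
    exact ⟨V, hV, fun p hp q hq => h (Set.mk_mem_prod hp hq)⟩
  have hall := eventually_all.2 hcoord
  rw [Prod.zero_eq_mk, Prod.zero_eq_mk, nhds_prod_eq, nhds_prod_eq, Filter.Eventually,
    mem_prod_iff] at hall
  obtain ⟨A, hA, B, hB, hAB⟩ := hall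
  obtain ⟨C, hC, D, hD, hCD⟩ := mem_prod_iff.1 hB
  -- The box `A × C × D` lies where common zeros satisfy `x = y`; intersecting its sides gives one
  -- neighbourhood whose cube lies in the box.
  refine ⟨V ∩ (A ∩ (C ∩ D)), inter_mem hV (inter_mem hA (inter_mem hC hD)), ?_⟩
  rintro p ⟨hpV, hpA, -, -⟩ q ⟨hqV, -, hqC, -⟩ r ⟨hrV, -, -, hrD⟩ ⟨hpq, hqr, hpr, hupq, huqr⟩
  have hw {a b : Plane 𝕜} (hab : u a = u b) (i : Fin 3) : selfDiff u i (a, b) = 0 := by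
    simp [selfDiff, hab]
  have hW {a b : Plane 𝕜} (ha : a ∈ V) (hb : b ∈ V) (hne : a ≠ b) (hab : u a = u b) (i j) :
      divMinor c i j (a, b) = 0 :=
    divMinor_eq_zero hne (fun i => by rw [← hVdiv a ha b hb i, hw hab]) i j
  have hS : ∀ j, tripleFun u c j (p, q, r) = 0 := by
    intro j
    fin_cases j
    exacts [hw hupq 0, hw hupq 1, hw hupq 2, hw huqr 0, hw huqr 1, hw huqr 2,
      hW hpV hqV hpq hupq 0 1, hW hpV hqV hpq hupq 0 2, hW hpV hqV hpq hupq 1 2,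
      hW hqV hrV hqr huqr 0 1, hW hqV hrV hqr huqr 0 2, hW hqV hrV hqr huqr 1 2,
      hW hpV hrV hpr (hupq.trans huqr) 0 1, hW hpV hrV hpr (hupq.trans huqr) 0 2,
      hW hpV hrV hpr (hupq.trans huqr) 1 2]
  exact hpq (funext fun k => sub_eq_zero.1
    (hAB (Set.mk_mem_prod hpA (hCD (Set.mk_mem_prod hqC hrD))) k hS))
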